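/- Let $p$ be a prime and let $\mathbb{Z}_p=\{a/b\mid a,b\in\mathbb{Z},\ p\nmid b\}$ be the localization of $\mathbb{Z}$ at $p$. For nonzero $a\in\mathbb{Z}_p$ let $[a]$ be the non-negative integer $r$ with $a\mathbb{Z}_p=p^r\mathbb{Z}_p$, and put $[0]=+\infty$. Let $0,\alpha,\beta$ be distinct integers and let $$R=\mathbb{Z}_p[X]/X(X-\alpha)(X-\beta)\mathbb{Z}_p[X].$$ An ideal $I$ of $R$ is called full if it has the same rank over $\mathbb{Z}_p$ as $R$, namely three. Let $$\zeta_R(s)=\sum_{I}|R:I|^{-s},$$ where $I$ runs through the full ideals of $R$. Assume that $([\alpha],[\beta],[\beta-\alpha])=(0,0,k)$ for an integer $k\ge 0$. Then every full ideal has index a power of $p$, there are only finitely many full ideals of each index, and, with $x=p^{-s}$, $$\zeta_R(s)=\frac{1-p^kx^{2k}}{1-px^2}\cdot\frac{1}{(1-x)^2}+\frac{p^kx^{2k}}{(1-x)^3}.$$ This holds as an identity of formal power series in $x$ (the coefficient of $x^n$ in $\zeta_R$ being the number of full ideals of index $p^n$), and also as an identity of functions of the complex variable $s$ for $\operatorname{Re}(s)>0$,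 where the series converges absolutely; at the points where $px^2=1$ the quotient $\frac{1-p^kx^{2k}}{1-px^2}$ is given the value $k$ of its removable singularity. Let $\zeta_V(s)_p$ be the factor at $p$ of the zeta function of the regular module $V$ of the semisimple algebra $A=\mathbb{Q}[X]/X(X-\alpha)(X-\beta)\mathbb{Q}[X]$, that is, the product of the Euler factors at $p$ of the Dedekind zeta functions of the simple components of $A$, and let $\delta_p$ be the rational function with $\delta_p(p^{-s})=\zeta_R(s)/\zeta_V(s)_p$. If $k=1$, then $\delta_p$ exists, is unique, and equals $$\delta_p(x)=1-x+px^2.$$ -/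

import Mathlib

noncomputable section

/-- The localization of the integers at the prime `p`: the ring of all fractions `a / b` with
`a, b` integers and `p` not dividing `b`. -/
abbrev LocZ (p : ℕ) [Fact p.Prime] : Type :=
  Localization.AtPrime (Ideal.span {(p : ℤ)})

/-- The exponent `[a]` of `a` in `LocZ p`: the natural number `r` for which `a` and `p ^ r` generate
the same ideal if `a` is nonzero, and `⊤` if `a = 0`. -/
def pExp (p : ℕ) [Fact p.Prime] (a : LocZ p) : ℕ∞ :=
  emultiplicity (p : LocZ p) a

/-- The ring `S[x] / x (x - α) (x - β) S[x]`. -/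
abbrev CubicRing (S : Type) [CommRing S] (α β : ℤ) : Type :=
  AdjoinRoot (Polynomial.X * (Polynomial.X - Polynomial.C (α : S)) *
    (Polynomial.X - Polynomial.C (β : S)))

/-- An ideal of a `LocZ p`-order is full if its rank over `LocZ p` is that of the order. -/
def IsFullIdeal (p : ℕ) [Fact p.Prime] {O : Type} [CommRing O] [Algebra (LocZ p) O]
    (I : Ideal O) : Prop :=
  Module.finrank (LocZ p) I = Module.finrank (LocZ p) O

/-- The index `|O : I|` of an ideal (and `0` if the index is infinite). -/
def idealIndex {O : Type} [CommRing O] (I : Ideal O) : ℕ :=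
  Nat.card (O ⧸ I)

/-- The zeta function of a `LocZ p`-order `O` as a formal power series in `x = p ^ (-s)`: the
coefficient of `x ^ n` is the number of full ideals of index `p ^ n`. -/
def formalZeta (p : ℕ) [Fact p.Prime] (O : Type) [CommRing O] [Algebra (LocZ p) O] :
    PowerSeries ℚ :=
  PowerSeries.mk fun n =>
    (Nat.card {I : Ideal O // IsFullIdeal p I ∧ idealIndex I = p ^ n} : ℚ)

/-- The Euler factor at `p` of the Dedekind zeta function of a number field `K`, as a formal power
series in `x = p ^ (-s)`: the product of `(1 - x ^ f(P))⁻¹` over the primes `P` above `p` of the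
ring of integers of `K`, where `p ^ f(P)` is the norm of `P`. -/
def dedekindFactor (p : ℕ) (K : Type) [CommRing K] : PowerSeries ℚ :=
  ∏ᶠ P : Ideal.primesOver (Ideal.span {(p : ℤ)}) (integralClosure ℤ K),
    (1 - (PowerSeries.X : PowerSeries ℚ) ^
      (P : Ideal (integralClosure ℤ K)).inertiaDeg ℤ)⁻¹

/-- The factor at `p` of the zeta function of the regular module of a finite-dimensional commutative
semisimple `ℚ`-algebra `A`, as a formal power series in `x = p ^ (-s)`: the product of the
Euler factors at `p` of the Dedekind zeta functions of the simple components `A / m` of `A`. -/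
def semisimpleFactor (p : ℕ) (A : Type) [CommRing A] : PowerSeries ℚ :=
  ∏ᶠ m : MaximalSpectrum A, dedekindFactor p (A ⧸ m.asIdeal)

/-- `δ` is the factor at `p` which compares the zeta function of `ℤ[x] / x (x - α) (x - β) ℤ[x]`
with that of the algebra `ℚ[x] / x (x - α) (x - β) ℚ[x]`: the rational function of `x = p ^ (-s)`
that is the quotient of the two local zeta functions, all of them being expanded at `x = 0`. -/
def IsDeltaFactor (p : ℕ) [Fact p.Prime] (α β : ℤ) (δ : RatFunc ℚ) : Prop :=
  (δ : LaurentSeries ℚ) =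
    HahnSeries.ofPowerSeries ℤ ℚ (formalZeta p (CubicRing (LocZ p) α β)) /
      HahnSeries.ofPowerSeries ℤ ℚ (semisimpleFactor p (CubicRing ℚ α β))

end

noncomputable section

open Polynomial QuadraticAlgebra

/-! Write O for the localization. As α and β are units, X and (X - α)(X - β) are comaximal, and R ≅
O × O[ω] with ω² = p^k ω, where X - α becomes a unit times ω in the second factor
(`CubicRing.exists_algEquiv`). Full rank means finite index, so a full ideal is a product of some
p^m O and an ideal J of finite index in O[ω].

Such a J has a Hermite basis p^a + cω, p^b ω with c determined modulo p^b; stability under ω is the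
single condition p^b ∣ p^a + c p^k (`exists_eq_hermiteIdeal`, `hermiteIdeal_eq_iff`). For b < k it
says b ≤ a, leaving p^b classes of c. For b ≥ k it forces a ≥ k and, with a = k + a', b = k + b', it
says c ≡ -p^a' mod p^b', leaving p^k classes of c mod p^b. The index of J is p^(a+b), so the zeta
function is (1-x)⁻¹ (∑_{b<k} p^b x^(2b) (1-x)⁻¹ + p^k x^(2k) (1-x)⁻²), and the inner sum is
geometric in p x². The same parametrization gives both the formal and the analytic identity.

The algebra A has three simple components, each isomorphic to ℚ, so its factor at p is (1-x)⁻³;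
dividing gives δ for k = 1. -/

/-- The numbers `0, …, p ^ n - 1` represent the residue classes of `O` modulo `p ^ n`. -/
def HasDigitResidues (p : ℕ) (O : Type*) [CommRing O] : Prop :=
  ∀ (n : ℕ) (c : O), ∃! i : Fin (p ^ n), (p : O) ^ n ∣ c - ((i : ℕ) : O)

/-! ### Residues and units in the localization at p -/

namespace LocZ

variable (p : ℕ) [hp : Fact p.Prime]

theorem span_ne_bot : Ideal.span {(p : ℤ)} ≠ ⊥ := by
  simpa using hp.out.ne_zero

instance : IsDiscreteValuationRing (LocZ p) :=
  IsLocalization.AtPrime.isDiscreteValuationRing_of_dedekind_domain ℤ (span_ne_bot p) _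

instance : (Ideal.span {(p : ℤ)}).IsMaximal :=
  Ideal.IsPrime.isMaximal inferInstance (span_ne_bot p)

theorem maximalIdeal_eq : IsLocalRing.maximalIdeal (LocZ p) = Ideal.span {(p : LocZ p)} := by
  rw [← IsLocalization.AtPrime.map_eq_maximalIdeal (Ideal.span {(p : ℤ)}), Ideal.map_span]
  simp

theorem irreducible_p : Irreducible (p : LocZ p) :=
  (IsDiscreteValuationRing.irreducible_iff_uniformizer _).2 (maximalIdeal_eq p)

theorem pow_dvd_intCast_iff (n : ℕ) (z : ℤ) :
    (p : LocZ p) ^ n ∣ (z : LocZ p) ↔ (p : ℤ) ^ n ∣ z := by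
  rw [← Ideal.mem_span_singleton, ← Ideal.mem_span_singleton, ← Ideal.span_singleton_pow,
    ← Ideal.span_singleton_pow, ← maximalIdeal_eq,
    ← IsLocalization.AtPrime.under_maximalIdeal_pow (Ideal.span {(p : ℤ)}) (LocZ p)]
  simp

theorem exists_intCast_sub (n : ℕ) (c : LocZ p) : ∃ z : ℤ, (p : LocZ p) ^ n ∣ c - z := by
  obtain ⟨y, hy⟩ := (IsLocalization.AtPrime.equivQuotMaximalIdealPow (Ideal.span {(p : ℤ)})
    (LocZ p) n).surjective (Ideal.Quotient.mk _ c)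
  obtain ⟨z, rfl⟩ := Ideal.Quotient.mk_surjective y
  refine ⟨z, ?_⟩
  rw [IsLocalization.AtPrime.equivQuotMaximalIdealPow_apply_mk, eq_comm, Ideal.Quotient.eq,
    maximalIdeal_eq, Ideal.span_singleton_pow, Ideal.mem_span_singleton] at hy
  simpa using hy

/-- Every class modulo p^n contains an integer z, and divisibility of integers by p^n is unchanged
by localizing, so the digit is z mod p^n. -/
theorem hasDigitResidues : HasDigitResidues p (LocZ p) := by
  intro n c
  obtain ⟨z, hz⟩ := exists_intCast_sub p n c
  have hpn : (0 : ℤ) < (p : ℤ) ^ n := by have := hp.out.pos; positivity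
  have key (i : Fin (p ^ n)) :
      (p : LocZ p) ^ n ∣ c - ((i : ℕ) : LocZ p) ↔ z % (p : ℤ) ^ n = (i : ℕ) := by
    have h1 : c - ((i : ℕ) : LocZ p) = (c - z) + ((z - (i : ℕ) : ℤ) : LocZ p) := by
      push_cast; ring
    have h2 : ((i : ℕ) : ℤ) % (p : ℤ) ^ n = (i : ℕ) :=
      Int.emod_eq_of_lt (by positivity) (by exact_mod_cast i.2)
    rw [h1, dvd_add_right hz, pow_dvd_intCast_iff, ← Int.emod_eq_emod_iff_emod_sub_eq_zero.trans
      Int.dvd_iff_emod_eq_zero.symm, h2]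
  have h0 := Int.emod_nonneg z hpn.ne'
  have hlt := Int.emod_lt_of_pos z hpn
  refine ⟨⟨(z % (p : ℤ) ^ n).toNat, by zify; rwa [Int.toNat_of_nonneg h0]⟩, ?_, ?_⟩
  · refine (key _).2 ?_
    simp [Int.toNat_of_nonneg h0]
  · intro i hi
    replace hi := (key i).1 hi
    ext
    simp [hi]

variable {p}

theorem isUnit_of_pExp_eq_zero {a : LocZ p} (h : pExp p a = 0) : IsUnit a := by
  rw [pExp, emultiplicity_eq_zero] at h
  by_contra hu
  exact h (Ideal.mem_span_singleton.1 (maximalIdeal_eq p ▸ (IsLocalRing.mem_maximalIdeal a).2 hu))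

theorem exists_unit_of_pExp_eq {a : LocZ p} {k : ℕ} (h : pExp p a = k) :
    ∃ v : (LocZ p)ˣ, a = v * (p : LocZ p) ^ k := by
  obtain ⟨⟨v, rfl⟩, hk⟩ := emultiplicity_eq_coe.1 h
  have hv : pExp p v = 0 := by
    rw [pExp, emultiplicity_eq_zero]
    rintro ⟨w, rfl⟩
    exact hk ⟨w, by ring⟩
  exact ⟨(isUnit_of_pExp_eq_zero hv).unit, by simp [mul_comm]⟩

end LocZ

namespace HasDigitResidues

variable {p : ℕ} {O : Type*} [CommRing O]

theorem index_span (h : HasDigitResidues p O) (n : ℕ) :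
    (Ideal.span {(p : O) ^ n}).toAddSubgroup.index = p ^ n := by
  let f : Fin (p ^ n) → O ⧸ Ideal.span {(p : O) ^ n} := fun i => Ideal.Quotient.mk _ ((i : ℕ) : O)
  have hf (c : O) (i : Fin (p ^ n)) : f i = Ideal.Quotient.mk _ c ↔
      (p : O) ^ n ∣ c - ((i : ℕ) : O) := by
    rw [eq_comm, Ideal.Quotient.eq, Ideal.mem_span_singleton]
  have hb : Function.Bijective f := by
    refine ⟨fun i j hij => ?_, fun y => ?_⟩
    · exact (h n ((j : ℕ) : O)).unique ((hf _ _).1 hij) (by simp)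
    · obtain ⟨c, rfl⟩ := Ideal.Quotient.mk_surjective y
      exact ⟨_, (hf _ _).2 (h n c).choose_spec.1⟩
  have := Nat.card_congr (Equiv.ofBijective f hb)
  rw [Nat.card_eq_fintype_card, Fintype.card_fin] at this
  exact this.symm

theorem eq_of_dvd_sub (hO : HasDigitResidues p O) {n : ℕ} {i j : Fin (p ^ n)}
    (h : (p : O) ^ n ∣ ((i : ℕ) : O) - ((j : ℕ) : O)) : i = j :=
  (hO n ((i : ℕ) : O)).unique (by simp) h

theorem finite_quotient_span_pow (hO : HasDigitResidues p O) (hp : p ≠ 0) (n : ℕ) :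
    Finite (O ⧸ Ideal.span {(p : O) ^ n}) :=
  Nat.finite_of_card_ne_zero <| (hO.index_span n).trans_ne (pow_ne_zero n hp)

end HasDigitResidues

/-- Split the index along J ≤ J + ker f: the upper step is the index of the image of J, the lower
one that of J ∩ ker f in ker f. -/
theorem AddSubgroup.index_eq_index_map_mul_index_comap {G H K : Type*} [AddCommGroup G]
    [AddCommGroup H] [AddCommGroup K] {f : G →+ H} (hf : Function.Surjective f) {g : K →+ G}
    (hgf : g.range = f.ker) (J : AddSubgroup G) :
    J.index = (J.map f).index * (J.comap g).index := by
  rw [AddSubgroup.index_map, AddSubgroup.index_comap, hgf, AddMonoidHom.range_eq_top.2 hf,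
    AddSubgroup.index_top, mul_one, ← AddSubgroup.relIndex_sup_right f.ker J, sup_comm, mul_comm,
    AddSubgroup.relIndex_mul_index le_sup_right]

/-! ### Hermite normal form of ideals in O[ω] -/

namespace QuadraticAlgebra

variable {O : Type*} [CommRing O] {r s : O}

/-- The ideal of the real parts of the elements of an ideal. -/
def reIdeal (J : Ideal (QuadraticAlgebra O r s)) : Ideal O :=
  (J.restrictScalars O).map (reₗ r s)

/-- The ideal of the `w` with `w ω` in a given ideal. -/
def imIdeal (J : Ideal (QuadraticAlgebra O r s)) : Ideal O where
  carrier := {w | (⟨0, w⟩ : QuadraticAlgebra O r s) ∈ J}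
  zero_mem' := J.zero_mem
  add_mem' {v w} hv hw := by
    rw [Set.mem_ofPred_eq]
    convert! J.add_mem hv hw using 1
    ext <;> simp
  smul_mem' c w hw := by
    rw [Set.mem_ofPred_eq]
    convert! J.mul_mem_left (algebraMap O _ c) hw using 1
    ext <;> simp

theorem mem_reIdeal {J : Ideal (QuadraticAlgebra O r s)} {u : O} :
    u ∈ reIdeal J ↔ ∃ w, ⟨u, w⟩ ∈ J :=
  ⟨fun ⟨z, hz, h⟩ => ⟨z.im, by rw [← h]; exact hz⟩, fun ⟨_, hw⟩ => ⟨_, hw, rfl⟩⟩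

theorem mem_imIdeal {J : Ideal (QuadraticAlgebra O r s)} {w : O} :
    w ∈ imIdeal J ↔ ⟨0, w⟩ ∈ J := Iff.rfl

theorem index_eq (J : Ideal (QuadraticAlgebra O r s)) :
    J.toAddSubgroup.index =
      (reIdeal J).toAddSubgroup.index * (imIdeal J).toAddSubgroup.index := by
  let g : O →+ QuadraticAlgebra O r s :=
    { toFun := fun w => ⟨0, w⟩, map_zero' := rfl, map_add' := fun v w => by ext <;> simp }
  refine (AddSubgroup.index_eq_index_map_mul_index_comap (f := (reₗ r s).toAddMonoidHom)
    (fun u => ⟨⟨u, 0⟩, rfl⟩) (g := g) ?_ J.toAddSubgroup)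
  ext z
  refine ⟨?_, fun h => ⟨z.im, ?_⟩⟩
  · rintro ⟨w, rfl⟩
    rfl
  · have h : z.re = 0 := h
    ext
    · exact h.symm
    · rfl

section Hermite

variable {p : ℕ} {k : ℕ}

/-- The ideal which is generated as an `O`-module by `p ^ a + c ω` and `p ^ b ω`. -/
def hermiteIdeal (a b : ℕ) (c : O) (h : (p : O) ^ b ∣ (p : O) ^ a + c * (p : O) ^ k) :
    Ideal (QuadraticAlgebra O 0 ((p : O) ^ k)) where
  carrier := {z | ∃ t, z.re = (p : O) ^ a * t ∧ (p : O) ^ b ∣ z.im - c * t}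
  zero_mem' := ⟨0, by simp⟩
  add_mem' := by
    rintro z w ⟨t, ht, ht'⟩ ⟨u, hu, hu'⟩
    refine ⟨t + u, by simp [ht, hu, mul_add], ?_⟩
    convert! dvd_add ht' hu' using 1
    simp only [im_add]
    ring
  smul_mem' := by
    rintro z w ⟨t, ht, ht'⟩
    -- With z the multiplier, the imaginary part of the product minus c times the new witness is
    -- (z.re + z.im p^k)(w.im - ct) + z.im t (p^a + c p^k).
    refine ⟨z.re * t, by simp [ht]; ring, ?_⟩
    convert! dvd_add ((ht'.mul_left z.re).add (ht'.mul_left (z.im * (p : O) ^ k)))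
      (h.mul_left (z.im * t)) using 1
    simp only [smul_eq_mul, im_mul, ht]
    ring

variable {a b : ℕ} {c : O} {h : (p : O) ^ b ∣ (p : O) ^ a + c * (p : O) ^ k}

theorem mem_hermiteIdeal {z : QuadraticAlgebra O 0 ((p : O) ^ k)} :
    z ∈ hermiteIdeal a b c h ↔ ∃ t, z.re = (p : O) ^ a * t ∧ (p : O) ^ b ∣ z.im - c * t := Iff.rfl

theorem reIdeal_hermiteIdeal : reIdeal (hermiteIdeal a b c h) = Ideal.span {(p : O) ^ a} := by
  ext u
  rw [mem_reIdeal, Ideal.mem_span_singleton]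
  exact ⟨fun ⟨_, t, ht, _⟩ => ⟨t, ht⟩, fun ⟨t, ht⟩ => ⟨c * t, t, ht, by simp⟩⟩

variable [IsDomain O]

theorem mk_mem_hermiteIdeal (hp : (p : O) ≠ 0) {t w : O} :
    ⟨(p : O) ^ a * t, w⟩ ∈ hermiteIdeal a b c h ↔ (p : O) ^ b ∣ w - c * t := by
  rw [mem_hermiteIdeal]
  refine ⟨?_, fun h => ⟨t, rfl, h⟩⟩
  rintro ⟨u, hu, hw⟩
  rwa [mul_left_cancel₀ (pow_ne_zero a hp) hu]

theorem imIdeal_hermiteIdeal (hp : (p : O) ≠ 0) :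
    imIdeal (hermiteIdeal a b c h) = Ideal.span {(p : O) ^ b} := by
  ext w
  rw [mem_imIdeal, Ideal.mem_span_singleton]
  simpa using mk_mem_hermiteIdeal (h := h) hp (t := 0) (w := w)

theorem index_hermiteIdeal (hp : (p : O) ≠ 0) (hO : HasDigitResidues p O) :
    (hermiteIdeal a b c h).toAddSubgroup.index = p ^ (a + b) := by
  rw [index_eq, reIdeal_hermiteIdeal, imIdeal_hermiteIdeal hp, hO.index_span, hO.index_span,
    pow_add]

/-- The real and imaginary ideals recover a and b; testing p^a + cω for membership then recovers c
modulo p^b. -/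
theorem hermiteIdeal_eq_iff (hp : Irreducible (p : O)) {a' b' : ℕ} {c' : O}
    {h' : (p : O) ^ b' ∣ (p : O) ^ a' + c' * (p : O) ^ k} :
    hermiteIdeal a b c h = hermiteIdeal a' b' c' h' ↔
      a = a' ∧ b = b' ∧ (p : O) ^ b ∣ c - c' := by
  have pow_inj {m n : ℕ} (hmn : Ideal.span {(p : O) ^ m} = Ideal.span {(p : O) ^ n}) : m = n := by
    refine le_antisymm ?_ ?_
    all_goals
      refine (pow_dvd_pow_iff hp.ne_zero hp.not_isUnit).1 ?_
      rw [← Ideal.span_singleton_le_span_singleton, hmn]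
  constructor
  · intro e
    obtain rfl : a = a' := pow_inj <| by
      rw [← reIdeal_hermiteIdeal (h := h), e, reIdeal_hermiteIdeal]
    obtain rfl : b = b' := pow_inj <| by
      rw [← imIdeal_hermiteIdeal (h := h) hp.ne_zero, e, imIdeal_hermiteIdeal hp.ne_zero]
    refine ⟨rfl, rfl, ?_⟩
    have := (mk_mem_hermiteIdeal (h := h') hp.ne_zero (t := 1) (w := c)).1 <| by
      rw [← e, mk_mem_hermiteIdeal hp.ne_zero]
      simp
    simpa using this
  · rintro ⟨rfl, rfl, hc⟩
    ext z
    refine exists_congr fun t => and_congr_right fun _ => ?_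
    rw [← dvd_add_left (hc.mul_right t)]
    ring_nf

theorem exists_eq_hermiteIdeal [IsDiscreteValuationRing O] [Infinite O] (hp : Irreducible (p : O))
    (J : Ideal (QuadraticAlgebra O 0 ((p : O) ^ k))) (hJ : J.toAddSubgroup.index ≠ 0) :
    ∃ (a b : ℕ) (c : O) (h : (p : O) ^ b ∣ (p : O) ^ a + c * (p : O) ^ k),
      J = hermiteIdeal a b c h := by
  rw [index_eq, mul_ne_zero_iff] at hJ
  -- The zero ideal of the infinite ring O has index 0 by convention.
  have ne_bot {I : Ideal O} (hI : I.toAddSubgroup.index ≠ 0) : I ≠ ⊥ := by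
    rintro rfl
    simp [AddSubgroup.index_bot] at hI
  obtain ⟨a, ha⟩ := IsDiscreteValuationRing.ideal_eq_span_pow_irreducible (ne_bot hJ.1) hp
  obtain ⟨b, hb⟩ := IsDiscreteValuationRing.ideal_eq_span_pow_irreducible (ne_bot hJ.2) hp
  obtain ⟨c, hc⟩ := mem_reIdeal.1 (ha ▸ Ideal.mem_span_singleton_self ((p : O) ^ a))
  have mem_iff (w : O) : ⟨0, w⟩ ∈ J ↔ (p : O) ^ b ∣ w := by
    rw [← mem_imIdeal, hb, Ideal.mem_span_singleton]
  -- Multiplying p^a + cω by ω gives (p^a + c p^k) ω.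
  have hdvd : (p : O) ^ b ∣ (p : O) ^ a + c * (p : O) ^ k := by
    rw [← mem_iff]
    convert! J.mul_mem_left ⟨0, 1⟩ hc using 1
    ext <;> simp [mul_comm]
  refine ⟨a, b, c, hdvd, ?_⟩
  have sub_eq (z : QuadraticAlgebra O 0 ((p : O) ^ k)) (t : O) (ht : z.re = (p : O) ^ a * t) :
      z = ⟨t, 0⟩ * ⟨(p : O) ^ a, c⟩ + ⟨0, z.im - c * t⟩ := by
    ext
    · simp [ht, mul_comm]
    · simp [mul_comm]
  ext z
  rw [mem_hermiteIdeal]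
  constructor
  · intro hz
    obtain ⟨t, ht⟩ : (p : O) ^ a ∣ z.re := by
      rw [← Ideal.mem_span_singleton, ← ha, mem_reIdeal]
      exact ⟨z.im, hz⟩
    refine ⟨t, ht, ?_⟩
    rw [sub_eq z t ht, J.add_mem_iff_right (J.mul_mem_left _ hc), mem_iff] at hz
    exact hz
  · rintro ⟨t, ht, h⟩
    rw [sub_eq z t ht]
    exact J.add_mem (J.mul_mem_left _ hc) ((mem_iff _).2 h)

end Hermite

end QuadraticAlgebra

/-! ### Enumeration of the ideals of finite index -/

/-- The parameters for the ideals of finite index in `O[ω]` with `ω ^ 2 = p ^ k ω`. -/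
abbrev QuadParam (p k : ℕ) : Type :=
  (Σ b : Fin k, Fin (p ^ (b : ℕ)) × ℕ) ⊕ (Fin (p ^ k) × ℕ × ℕ)

namespace QuadParam

variable {p k : ℕ}

/-- The exponent of the index of the ideal with given parameters. -/
def weight : QuadParam p k → ℕ :=
  Sum.elim (fun x => 2 * (x.1 : ℕ) + x.2.2) (fun y => 2 * k + (y.2.1 + y.2.2))

variable {O : Type*} [CommRing O]

/-- The ideal of `O[ω]` with given parameters. -/
def toIdeal : QuadParam p k → Ideal (QuadraticAlgebra O 0 ((p : O) ^ k))
  -- Case b < k: `d` is the class of c, and `a` is the excess of the first exponent over `b`.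
  | .inl ⟨b, d, a⟩ => hermiteIdeal (b + a) b ((d : ℕ) : O) <|
      dvd_add (pow_dvd_pow _ le_self_add) ((pow_dvd_pow _ b.2.le).mul_left _)
  -- Case of both exponents at least k: cancelling p^k from the condition gives p^b ∣ p^a + c, and
  -- `d` is the quotient modulo p^k.
  | .inr ⟨d, a, b⟩ => hermiteIdeal (k + a) (k + b) ((p : O) ^ b * ((d : ℕ) : O) - (p : O) ^ a)
      ⟨((d : ℕ) : O), by ring⟩

variable [IsDomain O]

theorem index_toIdeal (hp : Irreducible (p : O)) (hO : HasDigitResidues p O) (x : QuadParam p k) :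
    (toIdeal (O := O) x).toAddSubgroup.index = p ^ x.weight := by
  obtain ⟨b, d, a⟩ | ⟨d, a, b⟩ := x
  · rw [toIdeal, index_hermiteIdeal hp.ne_zero hO]
    congr 1
    simp only [weight, Sum.elim_inl]
    ring
  · rw [toIdeal, index_hermiteIdeal hp.ne_zero hO]
    congr 1
    simp only [weight, Sum.elim_inr]
    ring

theorem toIdeal_injective (hp : Irreducible (p : O)) (hO : HasDigitResidues p O) :
    Function.Injective (toIdeal (p := p) (k := k) (O := O)) := by
  rintro (⟨b, d, a⟩ | ⟨d, a, b⟩) (⟨b', d', a'⟩ | ⟨d', a', b'⟩) h <;>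
    simp only [toIdeal] at h <;> obtain ⟨h1, h2, h3⟩ := (hermiteIdeal_eq_iff hp).1 h
  · obtain rfl : b = b' := Fin.ext h2
    obtain rfl : a = a' := by omega
    obtain rfl := hO.eq_of_dvd_sub h3
    rfl
  · exact absurd b.2 (by omega)
  · exact absurd b'.2 (by omega)
  · obtain rfl : b = b' := by omega
    obtain rfl : a = a' := by omega
    rw [sub_sub_sub_cancel_right, ← mul_sub, pow_add, mul_comm,
      mul_dvd_mul_iff_left (pow_ne_zero _ hp.ne_zero)] at h3
    obtain rfl := hO.eq_of_dvd_sub h3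
    rfl

theorem exists_toIdeal_eq [IsDiscreteValuationRing O] [Infinite O] (hp : Irreducible (p : O))
    (hO : HasDigitResidues p O) (J : Ideal (QuadraticAlgebra O 0 ((p : O) ^ k)))
    (hJ : J.toAddSubgroup.index ≠ 0) : ∃ x : QuadParam p k, toIdeal x = J := by
  obtain ⟨a, b, c, h, rfl⟩ := exists_eq_hermiteIdeal hp J hJ
  have pow_le {m n : ℕ} : (p : O) ^ m ∣ (p : O) ^ n ↔ m ≤ n :=
    pow_dvd_pow_iff hp.ne_zero hp.not_isUnit
  obtain hb | hb := lt_or_ge b k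
  · have hab : b ≤ a := by
      rwa [dvd_add_left ((pow_dvd_pow _ hb.le).mul_left _), pow_le] at h
    obtain ⟨d, hd, -⟩ := hO b c
    refine ⟨.inl ⟨⟨b, hb⟩, d, a - b⟩, ?_⟩
    simp only [toIdeal]
    rw [hermiteIdeal_eq_iff hp]
    exact ⟨by omega, rfl, (dvd_sub_comm).1 hd⟩
  · obtain ⟨b, rfl⟩ := Nat.exists_eq_add_of_le hb
    -- Now p^k divides both p^b and c p^k, hence p^a.
    have hka : k ≤ a := by
      rw [← pow_le (n := a), ← dvd_add_left (dvd_mul_left ((p : O) ^ k) c)]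
      exact (pow_dvd_pow _ le_self_add).trans h
    obtain ⟨a, rfl⟩ := Nat.exists_eq_add_of_le hka
    rw [pow_add, pow_add, mul_comm c, ← mul_add,
      mul_dvd_mul_iff_left (pow_ne_zero _ hp.ne_zero)] at h
    obtain ⟨e, he⟩ := h
    obtain rfl : c = (p : O) ^ b * e - (p : O) ^ a := by rw [← he]; ring
    obtain ⟨d, hd, -⟩ := hO k e
    refine ⟨.inr ⟨d, a, b⟩, ?_⟩
    simp only [toIdeal]
    rw [hermiteIdeal_eq_iff hp]
    refine ⟨rfl, rfl, ?_⟩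
    rw [sub_sub_sub_cancel_right, ← mul_sub, pow_add, mul_comm]
    exact mul_dvd_mul_left _ (dvd_sub_comm.1 hd)

end QuadParam

/-- The ideals of finite index in `O × O[ω]`, with `ω ^ 2 = p ^ k ω`, in terms of parameters. -/
theorem exists_param_equiv_ideal {p k : ℕ} {O : Type*} [CommRing O] [IsDomain O]
    [IsDiscreteValuationRing O] [Infinite O] (hp : Irreducible (p : O))
    (hO : HasDigitResidues p O) (hp0 : p ≠ 0) :
    ∃ e : ℕ × QuadParam p k ≃ {I : Ideal (O × QuadraticAlgebra O 0 ((p : O) ^ k)) //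
        I.toAddSubgroup.index ≠ 0},
      ∀ x, (e x).1.toAddSubgroup.index = p ^ (x.1 + x.2.weight) := by
  let f (x : ℕ × QuadParam p k) : Ideal (O × QuadraticAlgebra O 0 ((p : O) ^ k)) :=
    Ideal.idealProdEquiv.symm (Ideal.span {(p : O) ^ x.1}, x.2.toIdeal)
  have index_prod (I : Ideal O) (J : Ideal (QuadraticAlgebra O 0 ((p : O) ^ k))) :
      (Ideal.idealProdEquiv.symm (I, J)).toAddSubgroup.index =
        I.toAddSubgroup.index * J.toAddSubgroup.index := by
    rw [← AddSubgroup.index_prod]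
    rfl
  have hf (x) : (f x).toAddSubgroup.index = p ^ (x.1 + x.2.weight) := by
    rw [index_prod, hO.index_span, QuadParam.index_toIdeal hp hO, pow_add]
  refine ⟨Equiv.ofBijective (fun x => ⟨f x, by rw [hf]; exact pow_ne_zero _ hp0⟩) ⟨?_, ?_⟩, hf⟩
  · rintro ⟨m, x⟩ ⟨n, y⟩ h
    have h := Ideal.idealProdEquiv.symm.injective (Subtype.ext_iff.1 h)
    obtain ⟨h1, h2⟩ := Prod.ext_iff.1 h
    obtain rfl := QuadParam.toIdeal_injective hp hO h2
    have h1 : Ideal.span {(p : O) ^ m} = Ideal.span {(p : O) ^ n} := h1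
    obtain rfl : m = n := by
      refine le_antisymm ?_ ?_
      all_goals
        refine (pow_dvd_pow_iff hp.ne_zero hp.not_isUnit).1 ?_
        rw [← Ideal.span_singleton_le_span_singleton, h1]
    rfl
  · rintro ⟨I, hI⟩
    obtain ⟨⟨I, J⟩, rfl⟩ := Ideal.idealProdEquiv.symm.surjective I
    rw [index_prod, mul_ne_zero_iff] at hI
    have hbot : I ≠ ⊥ := by
      rintro rfl
      simp [AddSubgroup.index_bot] at hI
    obtain ⟨m, rfl⟩ := IsDiscreteValuationRing.ideal_eq_span_pow_irreducible hbot hp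
    obtain ⟨x, rfl⟩ := QuadParam.exists_toIdeal_eq hp hO J hI.2
    exact ⟨(m, x), rfl⟩

/-! ### Full rank and finite index -/

instance LocZ.hasFiniteQuotients (p : ℕ) [hp : Fact p.Prime] :
    Ring.HasFiniteQuotients (LocZ p) where
  finiteQuotient hI := by
    obtain ⟨n, rfl⟩ :=
      IsDiscreteValuationRing.ideal_eq_span_pow_irreducible hI (LocZ.irreducible_p p)
    exact (LocZ.hasDigitResidues p).finite_quotient_span_pow hp.out.ne_zero n

/-- A finitely generated torsion module over a domain with finite quotients is finite. -/
theorem Module.IsTorsion.finite_of_hasFiniteQuotients {O M : Type*} [CommRing O] [IsDomain O]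
    [Ring.HasFiniteQuotients O] [AddCommGroup M] [Module O M] [Module.Finite O M]
    (h : Module.IsTorsion O M) : Finite M := by
  -- One nonzero d kills the finitely generated module, which is thus finitely generated over the
  -- finite ring O/d.
  obtain ⟨d, hdM, hd⟩ := Submodule.annihilator_top_inter_nonZeroDivisors h
  have hM : Module.IsTorsionBySet O M (Ideal.span {d} : Ideal O) := by
    rw [← Module.isTorsionBySet_iff_is_torsion_by_span]
    intro x
    rintro ⟨_, rfl⟩
    exact Submodule.mem_annihilator.1 hdM x trivial
  let _ := hM.module
  have : IsScalarTower O (O ⧸ Ideal.span {d}) M := hM.isScalarTower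
  have : Module.Finite (O ⧸ Ideal.span {d}) M := Module.Finite.of_restrictScalars_finite O _ _
  have : Finite (O ⧸ Ideal.span {d}) := Ring.HasFiniteQuotients.finiteQuotient <| by
    simpa using nonZeroDivisors.ne_zero hd
  exact Module.finite_of_finite (O ⧸ Ideal.span {d})

/-- The order of M annihilates M and is nonzero in O. -/
theorem Module.isTorsion_of_finite {O M : Type*} [CommRing O] [IsDomain O] [CharZero O]
    [AddCommGroup M] [Module O M] [Finite M] : Module.IsTorsion O M := by
  intro x
  have hM : (Nat.card M : O) ≠ 0 := Nat.cast_ne_zero.2 (Nat.card_ne_zero.2 ⟨⟨x⟩, inferInstance⟩)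
  refine ⟨⟨(Nat.card M : O), mem_nonZeroDivisors_of_ne_zero hM⟩, ?_⟩
  change (Nat.card M : O) • x = 0
  rw [Nat.cast_smul_eq_nsmul, card_nsmul_eq_zero']

/-- In an order over a domain with finite quotients, the ideals of full rank are those of finite
index. -/
theorem finrank_ideal_eq_iff_index_ne_zero {O R : Type*} [CommRing O] [IsDomain O] [CharZero O]
    [Ring.HasFiniteQuotients O] [CommRing R] [Algebra O R] [Module.Finite O R] (I : Ideal R) :
    Module.finrank O I = Module.finrank O R ↔ I.toAddSubgroup.index ≠ 0 := by
  have h : Module.finrank O (R ⧸ I.restrictScalars O) + Module.finrank O I =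
    Module.finrank O R := (I.restrictScalars O).finrank_quotient_add_finrank
  rw [show Module.finrank O I = Module.finrank O R ↔
      Module.finrank O (R ⧸ I.restrictScalars O) = 0 by omega,
    Module.finrank_eq_zero_iff_isTorsion]
  have hidx : I.toAddSubgroup.index ≠ 0 ↔ Finite (R ⧸ I.restrictScalars O) :=
    ⟨fun h => Nat.finite_of_card_ne_zero h,
      fun (_ : Finite (R ⧸ I)) => (Nat.card_pos (α := R ⧸ I)).ne'⟩
  rw [hidx]
  exact ⟨fun h => h.finite_of_hasFiniteQuotients, fun _ => Module.isTorsion_of_finite⟩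

theorem Ideal.index_comap_ringEquiv {R T : Type*} [CommRing R] [CommRing T] (f : R ≃+* T)
    (I : Ideal T) : (I.comap f).toAddSubgroup.index = I.toAddSubgroup.index :=
  I.toAddSubgroup.index_comap_of_surjective (f := f.toAddEquiv.toAddMonoidHom) f.surjective

/-! ### Splitting of the cubic ring -/

namespace CubicRing

variable {S : Type} [CommRing S] (α β : ℤ)

theorem monic : (X * (X - C (α : S)) * (X - C (β : S))).Monic :=
  (monic_X.mul (monic_X_sub_C _)).mul (monic_X_sub_C _)

instance : Module.Finite S (CubicRing S α β) := (monic α β).finite_adjoinRoot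

instance : Module.Free S (CubicRing S α β) := (monic α β).free_adjoinRoot

theorem finrank_eq [Nontrivial S] : Module.finrank S (CubicRing S α β) = 3 := by
  rw [(AdjoinRoot.powerBasis' (monic α β)).finrank, AdjoinRoot.powerBasis'_dim,
    (monic_X.mul (monic_X_sub_C _)).natDegree_mul (monic_X_sub_C _),
    monic_X.natDegree_mul (monic_X_sub_C _), natDegree_X, natDegree_X_sub_C,
    natDegree_X_sub_C]

/-- The decomposition of `S[x] / x (x - α) (x - β) S[x]` when `α` and `β` are units. -/
theorem exists_algEquiv [Nontrivial S] {α β : ℤ} {π : S} (hα : IsUnit (α : S)) (hβ : IsUnit (β : S))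
    (v : Sˣ) (hv : (β : S) - α = v * π) :
    Nonempty (CubicRing S α β ≃ₐ[S] S × QuadraticAlgebra S 0 π) := by
  -- The image of X: 0 in the first factor, α + vω in the second, where (X - α)(X - β) becomes v²ω(ω
  -- - π) = 0.
  let x : S × QuadraticAlgebra S 0 π := (0, ⟨α, v⟩)
  have hx : aeval x (X * (X - C (α : S)) * (X - C (β : S))) = 0 := by
    simp only [map_mul, map_sub, aeval_X, aeval_C]
    have hβ' : (β : S) = α + v * π := by rw [← hv]; ring
    ext
    · simp [x]
    · simp [x, hβ']
    · simp [x, hβ']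
      ring
  let f : CubicRing S α β →ₐ[S] S × QuadraticAlgebra S 0 π :=
    AdjoinRoot.liftAlgHom _ (Algebra.ofId _ _) x hx
  have hf : f (AdjoinRoot.root _) = x := AdjoinRoot.liftAlgHom_root ..
  obtain ⟨a, ha⟩ := hα.exists_left_inv
  obtain ⟨b, hb⟩ := hβ.exists_left_inv
  have hfsurj : Function.Surjective f := by
    rintro ⟨u, r, w⟩
    let y : CubicRing S α β := AdjoinRoot.root _
    -- At X = 0 the product (X - α)(X - β) is αβ; dividing by it gives a preimage of (1, 0).
    let e : CubicRing S α β := (a * b) • ((y - algebraMap S _ α) * (y - algebraMap S _ β))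
    have hβ' : (β : S) = α + v * π := by rw [← hv]; ring
    have he : f e = (1, 0) := by
      simp only [e, y, map_smul, map_mul, map_sub, hf, AlgHom.commutes]
      ext
      · simp only [x, Prod.smul_fst, Prod.fst_mul, Prod.fst_sub, Prod.algebraMap_apply,
          Algebra.algebraMap_self, RingHom.id_apply, smul_eq_mul]
        linear_combination hb + b * β * ha
      · simp [x]
      · simp [x, hβ']
        ring
    -- The element y - α + αe maps to (0, vω).
    refine ⟨u • e + r • (1 - e) + (w * (v⁻¹ : Sˣ)) •
      (y - algebraMap S _ α + algebraMap S _ α * e), ?_⟩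
    simp only [y, map_add, map_smul, map_mul, map_sub, map_one, he, hf, AlgHom.commutes]
    ext <;> simp [x, QuadraticAlgebra.re_one, QuadraticAlgebra.im_one]
  refine ⟨AlgEquiv.ofBijective f
    (OrzechProperty.bijective_of_surjective_of_finrank_le f.toLinearMap hfsurj ?_)⟩
  rw [finrank_eq, Module.finrank_prod, QuadraticAlgebra.finrank_eq_two, Module.finrank_self]

end CubicRing

/-! ### Generating functions, formal and analytic -/

/-- `F` is the generating function of the weight `w`: all fibres of `w` are finite, and the
coefficients of `F` are their cardinalities. -/
def HasGenFun {T : Type*} (w : T → ℕ) (F : PowerSeries ℚ) : Prop :=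
  ∀ n, Finite {t // w t = n} ∧ PowerSeries.coeff n F = Nat.card {t // w t = n}

namespace HasGenFun

variable {T T' : Type*} {w : T → ℕ} {w' : T' → ℕ} {F F' : PowerSeries ℚ}

theorem id : HasGenFun (fun n : ℕ => n) (PowerSeries.mk 1) := fun n =>
  ⟨inferInstance, by simp⟩

theorem const (T : Type*) [Fintype T] (d : ℕ) :
    HasGenFun (fun _ : T => d) ((Fintype.card T : PowerSeries ℚ) * PowerSeries.X ^ d) := by
  refine fun n => ⟨inferInstance, ?_⟩
  rw [← map_natCast (PowerSeries.C (R := ℚ)), PowerSeries.coeff_C_mul, PowerSeries.coeff_X_pow]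
  by_cases h : n = d
  · simp [h]
  · simp [h, Ne.symm h]

theorem sum (h : HasGenFun w F) (h' : HasGenFun w' F') :
    HasGenFun (Sum.elim w w') (F + F') := by
  intro n
  have := (h n).1
  have := (h' n).1
  let e : {t // Sum.elim w w' t = n} ≃ {t // w t = n} ⊕ {t // w' t = n} := Equiv.subtypeSum
  exact ⟨.of_equiv _ e.symm, by
    rw [map_add, (h n).2, (h' n).2, Nat.card_congr e, Nat.card_sum, Nat.cast_add]⟩

theorem sigma {ι : Type*} [Fintype ι] {S : ι → Type*} {w : ∀ i, S i → ℕ}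
    {F : ι → PowerSeries ℚ} (h : ∀ i, HasGenFun (w i) (F i)) :
    HasGenFun (fun x : Σ i, S i => w x.1 x.2) (∑ i, F i) := by
  intro n
  have := fun i => (h i n).1
  let e : {x : Σ i, S i // w x.1 x.2 = n} ≃ Σ i, {t // w i t = n} :=
    { toFun := fun x => ⟨x.1.1, x.1.2, x.2⟩
      invFun := fun x => ⟨⟨x.1, x.2.1⟩, x.2.2⟩ }
  exact ⟨.of_equiv _ e.symm, by
    rw [map_sum, Nat.card_congr e, Nat.card_sigma, Nat.cast_sum]
    exact Finset.sum_congr rfl fun i _ => (h i n).2⟩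

theorem prod (h : HasGenFun w F) (h' : HasGenFun w' F') :
    HasGenFun (fun x : T × T' => w x.1 + w' x.2) (F * F') := by
  intro n
  have := fun i => (h i).1
  have := fun i => (h' i).1
  let e : {x : T × T' // w x.1 + w' x.2 = n} ≃
      Σ ij : Finset.HasAntidiagonal.antidiagonal n, {t // w t = ij.1.1} × {t // w' t = ij.1.2} :=
    { toFun := fun x => ⟨⟨(w x.1.1, w' x.1.2), by simpa using x.2⟩, ⟨x.1.1, rfl⟩, ⟨x.1.2, rfl⟩⟩
      invFun := fun x => ⟨(x.2.1.1, x.2.2.1), by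
        rw [x.2.1.2, x.2.2.2]; exact Finset.HasAntidiagonal.mem_antidiagonal.1 x.1.2⟩
      left_inv := fun _ => rfl
      right_inv := by
        rintro ⟨⟨⟨i, j⟩, hij⟩, ⟨t, ht⟩, ⟨t', ht'⟩⟩
        obtain rfl : w t = i := ht
        obtain rfl : w' t' = j := ht'
        rfl }
  exact ⟨.of_equiv _ e.symm, by
    rw [PowerSeries.coeff_mul, Nat.card_congr e, Nat.card_sigma, Nat.cast_sum,
      Finset.univ_eq_attach, ← Finset.sum_attach]
    refine Finset.sum_congr rfl fun ij _ => ?_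
    rw [(h _).2, (h' _).2, Nat.card_prod, Nat.cast_mul]⟩

theorem mk_natCard_eq (h : HasGenFun w F) {S : ℕ → Type*} (e : ∀ n, S n ≃ {t // w t = n}) :
    PowerSeries.mk (fun n => (Nat.card (S n) : ℚ)) = F := by
  ext n
  rw [PowerSeries.coeff_mk, (h n).2, Nat.card_congr (e n)]

end HasGenFun

theorem HasSum.sigma_fintype {ι : Type*} [Fintype ι] {S : ι → Type*} {f : ∀ i, S i → ℂ}
    {a : ι → ℂ} (h : ∀ i, HasSum (f i) (a i)) :
    HasSum (fun x : Σ i, S i => f x.1 x.2) (∑ i, a i) := by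
  refine HasSum.sigma_of_hasSum (hasSum_fintype a) h (Summable.of_norm ?_)
  rw [summable_sigma_of_nonneg fun _ => norm_nonneg _]
  exact ⟨fun i => (h i).summable.norm, (hasSum_fintype _).summable⟩

theorem HasSum.prod_mul {S T : Type*} {f : S → ℂ} {g : T → ℂ} {a b : ℂ} (hf : HasSum f a)
    (hg : HasSum g b) : HasSum (fun x : S × T => f x.1 * g x.2) (a * b) :=
  hf.mul hg (summable_mul_of_summable_norm hf.summable.norm hg.summable.norm)

namespace QuadParam

variable {p k : ℕ}

/-- Each free exponent contributes a geometric series, each set of digits a monomial p^b x^(2b) or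
p^k x^(2k). -/
theorem hasGenFun_add_weight :
    HasGenFun (fun y : ℕ × QuadParam p k => y.1 + y.2.weight)
      (PowerSeries.mk 1 * (∑ b : Fin k, ((p : PowerSeries ℚ) ^ (b : ℕ) *
        PowerSeries.X ^ (2 * (b : ℕ)) * PowerSeries.mk 1) +
        (p : PowerSeries ℚ) ^ k * PowerSeries.X ^ (2 * k) *
          (PowerSeries.mk 1 * PowerSeries.mk 1))) := by
  refine HasGenFun.id.prod (HasGenFun.sum (HasGenFun.sigma
    (S := fun b : Fin k => Fin (p ^ (b : ℕ)) × ℕ)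
    (w := fun b x => 2 * (b : ℕ) + x.2) fun b => ?_) ?_)
  · simpa using (HasGenFun.const (Fin (p ^ (b : ℕ))) (2 * (b : ℕ))).prod HasGenFun.id
  · simpa using (HasGenFun.const (Fin (p ^ k)) (2 * k)).prod (HasGenFun.id.prod HasGenFun.id)

theorem hasSum_pow_add_weight {x : ℂ} (hx : ‖x‖ < 1) :
    HasSum (fun y : ℕ × QuadParam p k => x ^ (y.1 + y.2.weight))
      ((1 - x)⁻¹ * (∑ b : Fin k, ((p : ℂ) ^ (b : ℕ) * x ^ (2 * (b : ℕ)) * (1 - x)⁻¹) +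
        (p : ℂ) ^ k * x ^ (2 * k) * ((1 - x)⁻¹ * (1 - x)⁻¹))) := by
  have hg := hasSum_geometric_of_norm_lt_one hx
  have hc (d e : ℕ) : HasSum (fun _ : Fin (p ^ e) => x ^ d) ((p : ℂ) ^ e * x ^ d) := by
    simpa using hasSum_fintype fun _ : Fin (p ^ e) => x ^ d
  have h1 := HasSum.sigma_fintype fun b : Fin k => (hc (2 * (b : ℕ)) b).prod_mul hg
  have h2 := (hc (2 * k) k).prod_mul (hg.prod_mul hg)
  convert! hg.prod_mul (HasSum.sum (f := Sum.elim _ _) h1 h2) using 2 with y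
  obtain ⟨m, y | y⟩ := y <;> simp [weight, pow_add]

theorem genFun_eq :
    (PowerSeries.mk 1 * (∑ b : Fin k, ((p : PowerSeries ℚ) ^ (b : ℕ) *
        PowerSeries.X ^ (2 * (b : ℕ)) * PowerSeries.mk 1) +
        (p : PowerSeries ℚ) ^ k * PowerSeries.X ^ (2 * k) *
          (PowerSeries.mk 1 * PowerSeries.mk 1))) =
      (1 - (p : PowerSeries ℚ) ^ k * PowerSeries.X ^ (2 * k)) *
          (1 - (p : PowerSeries ℚ) * PowerSeries.X ^ 2)⁻¹ * ((1 - PowerSeries.X) ^ 2)⁻¹ +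
        (p : PowerSeries ℚ) ^ k * PowerSeries.X ^ (2 * k) * ((1 - PowerSeries.X) ^ 3)⁻¹ := by
  have hG : (PowerSeries.mk 1 : PowerSeries ℚ) * (1 - PowerSeries.X) = 1 :=
    PowerSeries.mk_one_mul_one_sub_eq_one ℚ
  have hinv (n : ℕ) : ((1 - PowerSeries.X : PowerSeries ℚ) ^ n)⁻¹ = PowerSeries.mk 1 ^ n := by
    rw [eq_comm, PowerSeries.eq_inv_iff_mul_eq_one (by simp), ← mul_pow, hG, one_pow]
  have hgeom : ∑ b : Fin k, (p : PowerSeries ℚ) ^ (b : ℕ) * PowerSeries.X ^ (2 * (b : ℕ)) =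
      (1 - (p : PowerSeries ℚ) ^ k * PowerSeries.X ^ (2 * k)) *
          (1 - (p : PowerSeries ℚ) * PowerSeries.X ^ 2)⁻¹ := by
    rw [PowerSeries.eq_mul_inv_iff_mul_eq (by simp)]
    simp_rw [pow_mul, ← mul_pow]
    rw [Fin.sum_univ_eq_sum_range (fun b => ((p : PowerSeries ℚ) * PowerSeries.X ^ 2) ^ b),
      geom_sum_mul_neg]
  rw [← Finset.sum_mul, hgeom, hinv, hinv]
  ring

theorem sum_value_eq {x : ℂ} (hpx : (p : ℂ) * x ^ 2 ≠ 1) :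
    ((1 - x)⁻¹ * (∑ b : Fin k, ((p : ℂ) ^ (b : ℕ) * x ^ (2 * (b : ℕ)) * (1 - x)⁻¹) +
        (p : ℂ) ^ k * x ^ (2 * k) * ((1 - x)⁻¹ * (1 - x)⁻¹))) =
    (1 - (p : ℂ) ^ k * x ^ (2 * k)) / (1 - (p : ℂ) * x ^ 2) * (1 / (1 - x) ^ 2) +
            (p : ℂ) ^ k * x ^ (2 * k) / (1 - x) ^ 3 := by
  have hgeom : ∑ b : Fin k, (p : ℂ) ^ (b : ℕ) * x ^ (2 * (b : ℕ)) =
      (1 - (p : ℂ) ^ k * x ^ (2 * k)) / (1 - (p : ℂ) * x ^ 2) := by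
    rw [eq_div_iff (sub_ne_zero.2 hpx.symm)]
    simp_rw [pow_mul, ← mul_pow]
    rw [Fin.sum_univ_eq_sum_range (fun b => ((p : ℂ) * x ^ 2) ^ b), geom_sum_mul_neg]
  rw [← Finset.sum_mul, hgeom]
  simp only [div_eq_mul_inv, ← inv_pow]
  ring

theorem sum_value_eq_of_eq_one {x : ℂ} (hpx : (p : ℂ) * x ^ 2 = 1) :
    ((1 - x)⁻¹ * (∑ b : Fin k, ((p : ℂ) ^ (b : ℕ) * x ^ (2 * (b : ℕ)) * (1 - x)⁻¹) +
        (p : ℂ) ^ k * x ^ (2 * k) * ((1 - x)⁻¹ * (1 - x)⁻¹))) =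
    (k : ℂ) * (1 / (1 - x) ^ 2) + (p : ℂ) ^ k * x ^ (2 * k) / (1 - x) ^ 3 := by
  have hgeom : ∑ b : Fin k, (p : ℂ) ^ (b : ℕ) * x ^ (2 * (b : ℕ)) = k := by
    simp_rw [pow_mul, ← mul_pow, hpx]
    simp
  rw [← Finset.sum_mul, hgeom]
  simp only [div_eq_mul_inv, ← inv_pow]
  ring

end QuadParam

/-! ### Euler factors of the semisimple algebra -/

theorem Ideal.inertiaDeg_eq_one_of_surjective {R S : Type*} [CommRing R] [CommRing S] [Algebra R S]
    (h : Function.Surjective (algebraMap R S)) (p : Ideal R) (q : Ideal S) [p.IsMaximal]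
    [q.IsMaximal] [q.LiesOver p] : q.inertiaDeg R = 1 := by
  rw [Ideal.inertiaDeg_eq_of_isMaximal p q]
  let _ : Field (R ⧸ p) := Ideal.Quotient.field p
  refine finrank_eq_one (1 : S ⧸ q) one_ne_zero fun w => ?_
  obtain ⟨s, rfl⟩ := Ideal.Quotient.mk_surjective w
  obtain ⟨r, rfl⟩ := h s
  exact ⟨Ideal.Quotient.mk p r, by rw [Algebra.smul_def, mul_one]; rfl⟩

/-- ℤ is integrally closed in ℚ. -/
theorem bijective_algebraMap_integralClosure {K : Type} [CommRing K] (e : K ≃+* ℚ) :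
    Function.Bijective (algebraMap ℤ (integralClosure ℤ K)) := by
  constructor
  · intro m n h
    have h := congrArg (fun b : integralClosure ℤ K => e b) h
    simpa using h
  · rintro ⟨b, hb⟩
    obtain ⟨n, hn⟩ := IsIntegrallyClosed.isIntegral_iff.1 (hb.map e.toRingHom.toIntAlgHom)
    refine ⟨n, Subtype.ext (e.injective ?_)⟩
    simpa using hn

/-- The Euler factor at `p` of the Riemann zeta function. -/
theorem dedekindFactor_of_ringEquiv_rat (p : ℕ) [hp : Fact p.Prime] {K : Type} [CommRing K]
    (e : K ≃+* ℚ) : dedekindFactor p K = (1 - PowerSeries.X)⁻¹ := by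
  have hb := bijective_algebraMap_integralClosure e
  let φ : ℤ ≃+* integralClosure ℤ K := RingEquiv.ofBijective _ hb
  let P : Ideal (integralClosure ℤ K) := (Ideal.span {(p : ℤ)}).map φ
  have hP : P.IsMaximal := Ideal.map_isMaximal_of_equiv φ
  have hover : P.LiesOver (Ideal.span {(p : ℤ)}) :=
    ⟨(Ideal.comap_map_of_bijective _ hb).symm⟩
  let _ : Unique (Ideal.primesOver (Ideal.span {(p : ℤ)}) (integralClosure ℤ K)) :=
    { default := ⟨P, hP.isPrime, hover⟩
      uniq := fun Q => Subtype.ext <| by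
        exact (Ideal.map_comap_of_surjective _ hb.2 Q.1).symm.trans
          (congrArg (Ideal.map _) Q.2.2.over.symm) }
  rw [dedekindFactor, finprod_unique]
  have : P.inertiaDeg ℤ = 1 :=
    Ideal.inertiaDeg_eq_one_of_surjective hb.2 (Ideal.span {(p : ℤ)}) P
  change (1 - PowerSeries.X ^ P.inertiaDeg ℤ)⁻¹ = _
  rw [this, pow_one]

namespace CubicRing

variable {α β : ℤ}

/-- The evaluation of `ℚ[x] / x (x - α) (x - β) ℚ[x]` at a root of `x (x - α) (x - β)`. -/
def evalAt (α β : ℤ) (r : ({0, (α : ℚ), (β : ℚ)} : Finset ℚ)) : CubicRing ℚ α β →ₐ[ℚ] ℚ :=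
  AdjoinRoot.liftAlgHom _ (Algebra.ofId ℚ ℚ) r.1 <| by
    obtain ⟨r, hr⟩ := r
    simp only [Finset.mem_insert, Finset.mem_singleton] at hr
    obtain rfl | rfl | rfl := hr <;> simp

theorem evalAt_mk (r : ({0, (α : ℚ), (β : ℚ)} : Finset ℚ)) (f : ℚ[X]) :
    evalAt α β r (AdjoinRoot.mk _ f) = f.eval r.1 := by
  rw [evalAt, AdjoinRoot.liftAlgHom_mk]
  rfl

theorem evalAt_surjective (r : ({0, (α : ℚ), (β : ℚ)} : Finset ℚ)) :
    Function.Surjective (evalAt α β r) :=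
  fun q => ⟨algebraMap _ _ q, AlgHom.commutes _ _⟩

theorem ker_evalAt_isMaximal (r : ({0, (α : ℚ), (β : ℚ)} : Finset ℚ)) :
    (RingHom.ker (evalAt α β r)).IsMaximal :=
  RingHom.ker_isMaximal_of_surjective _ (evalAt_surjective r)

/-- The product of the three linear factors vanishes, so the prime m contains some X - r, hence the
maximal kernel at r. -/
theorem exists_ker_evalAt_eq (m : Ideal (CubicRing ℚ α β)) [hm : m.IsMaximal] :
    ∃ r, RingHom.ker (evalAt α β r) = m := by
  have hroot : ∃ r : ({0, (α : ℚ), (β : ℚ)} : Finset ℚ), AdjoinRoot.mk _ (X - C r.1) ∈ m := by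
    have h0 : AdjoinRoot.mk (X * (X - C (α : ℚ)) * (X - C (β : ℚ)))
        (X * (X - C (α : ℚ)) * (X - C (β : ℚ))) ∈ m := by
      rw [AdjoinRoot.mk_self]
      exact m.zero_mem
    rw [map_mul, map_mul] at h0
    obtain h | h := hm.isPrime.mem_or_mem h0
    · obtain h | h := hm.isPrime.mem_or_mem h
      · exact ⟨⟨0, by simp⟩, by simpa using h⟩
      · exact ⟨⟨α, by simp⟩, h⟩
    · exact ⟨⟨β, by simp⟩, h⟩
  obtain ⟨r, hr⟩ := hroot
  refine ⟨r, (ker_evalAt_isMaximal r).eq_of_le hm.ne_top fun z hz => ?_⟩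
  obtain ⟨f, rfl⟩ := AdjoinRoot.mk_surjective z
  rw [RingHom.mem_ker, evalAt_mk] at hz
  obtain ⟨g, rfl⟩ := dvd_iff_isRoot.2 hz
  rw [map_mul]
  exact m.mul_mem_right _ hr

theorem natCard_maximalSpectrum (hα : α ≠ 0) (hβ : β ≠ 0) (hαβ : α ≠ β) :
    Nat.card (MaximalSpectrum (CubicRing ℚ α β)) = 3 := by
  let f (r : ({0, (α : ℚ), (β : ℚ)} : Finset ℚ)) : MaximalSpectrum (CubicRing ℚ α β) :=
    ⟨RingHom.ker (evalAt α β r), ker_evalAt_isMaximal r⟩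
  have hf : Function.Bijective f := by
    refine ⟨fun r r' h => ?_, fun m => ?_⟩
    · have h : RingHom.ker (evalAt α β r) = RingHom.ker (evalAt α β r') :=
        congrArg MaximalSpectrum.asIdeal h
      have hr : AdjoinRoot.mk _ (X - C r.1) ∈ RingHom.ker (evalAt α β r) := by
        rw [RingHom.mem_ker, evalAt_mk]
        simp
      rw [h, RingHom.mem_ker, evalAt_mk] at hr
      exact Subtype.ext (by simpa [sub_eq_zero, eq_comm] using hr)
    · have := m.isMaximal
      obtain ⟨r, hr⟩ := exists_ker_evalAt_eq m.asIdeal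
      exact ⟨r, MaximalSpectrum.ext hr⟩
  rw [← Nat.card_congr (Equiv.ofBijective f hf), Nat.card_eq_fintype_card, Fintype.card_coe]
  refine Finset.card_eq_three.2 ⟨0, α, β, ?_, ?_, ?_, rfl⟩
  · exact_mod_cast hα.symm
  · exact_mod_cast hβ.symm
  · exact_mod_cast hαβ

theorem semisimpleFactor_eq (p : ℕ) [Fact p.Prime] (hα : α ≠ 0) (hβ : β ≠ 0) (hαβ : α ≠ β) :
    semisimpleFactor p (CubicRing ℚ α β) = (1 - PowerSeries.X)⁻¹ ^ 3 := by
  have hcard := natCard_maximalSpectrum hα hβ hαβ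
  have : Finite (MaximalSpectrum (CubicRing ℚ α β)) :=
    Nat.finite_of_card_ne_zero (by rw [hcard]; decide)
  let _ := Fintype.ofFinite (MaximalSpectrum (CubicRing ℚ α β))
  have hfactor (m : MaximalSpectrum (CubicRing ℚ α β)) :
      dedekindFactor p (CubicRing ℚ α β ⧸ m.asIdeal) = (1 - PowerSeries.X)⁻¹ := by
    have := m.isMaximal
    obtain ⟨r, hr⟩ := exists_ker_evalAt_eq m.asIdeal
    exact dedekindFactor_of_ringEquiv_rat p <| (Ideal.quotEquivOfEq hr.symm).trans <|
      RingHom.quotientKerEquivOfSurjective (evalAt_surjective r)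
  rw [semisimpleFactor, finprod_congr hfactor, finprod_eq_prod_of_fintype, Finset.prod_const,
    Finset.card_univ, ← Nat.card_eq_fintype_card, hcard]

end CubicRing

/-! ### Assembly of the theorem -/

/-- The full ideals of `LocZ p[x] / x (x - α) (x - β) LocZ p[x]` in terms of parameters. -/
theorem exists_param_equiv_fullIdeal (p : ℕ) [hp : Fact p.Prime] (α β : ℤ) (k : ℕ)
    (hα : pExp p (α : LocZ p) = 0) (hβ : pExp p (β : LocZ p) = 0)
    (hβα : pExp p ((β : LocZ p) - (α : LocZ p)) = k) :
    ∃ e : ℕ × QuadParam p k ≃ {I : Ideal (CubicRing (LocZ p) α β) // IsFullIdeal p I},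
      ∀ y, idealIndex (e y).1 = p ^ (y.1 + y.2.weight) := by
  have hcharZero : CharZero (LocZ p) :=
    charZero_of_injective_algebraMap (R := ℤ) (IsLocalization.injective _
      (Ideal.span {(p : ℤ)}).primeCompl_le_nonZeroDivisors)
  obtain ⟨v, hv⟩ := LocZ.exists_unit_of_pExp_eq hβα
  obtain ⟨f⟩ := CubicRing.exists_algEquiv (LocZ.isUnit_of_pExp_eq_zero hα)
    (LocZ.isUnit_of_pExp_eq_zero hβ) v hv
  obtain ⟨e, he⟩ := exists_param_equiv_ideal (k := k) (LocZ.irreducible_p p)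
    (LocZ.hasDigitResidues p) hp.out.ne_zero
  let φ := f.toRingEquiv
  have hidx := Ideal.index_comap_ringEquiv φ
  let g : {I : Ideal (LocZ p × QuadraticAlgebra (LocZ p) 0 ((p : LocZ p) ^ k)) //
      I.toAddSubgroup.index ≠ 0} ≃
      {I : Ideal (CubicRing (LocZ p) α β) // IsFullIdeal p I} :=
    φ.idealComapOrderIso.toEquiv.subtypeEquiv fun I => by
      rw [IsFullIdeal, finrank_ideal_eq_iff_index_ne_zero]
      exact not_congr (by rw [← hidx]; rfl)
  exact ⟨e.trans g, fun y => (hidx (e y).1).trans (he y)⟩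

/-- Uniqueness comes from the injectivity of the expansion of rational functions as Laurent series.
-/
theorem isDeltaFactor_iff (p : ℕ) [Fact p.Prime] {α β : ℤ} (hα : α ≠ 0) (hβ : β ≠ 0)
    (hαβ : α ≠ β)
    (hζ : formalZeta p (CubicRing (LocZ p) α β) =
      (1 - PowerSeries.X + (p : PowerSeries ℚ) * PowerSeries.X ^ 2) *
        (1 - PowerSeries.X)⁻¹ ^ 3) (δ : RatFunc ℚ) :
    IsDeltaFactor p α β δ ↔ δ = 1 - RatFunc.X + (p : RatFunc ℚ) * RatFunc.X ^ 2 := by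
  have hne : HahnSeries.ofPowerSeries ℤ ℚ ((1 - PowerSeries.X)⁻¹ ^ 3) ≠ 0 := by
    rw [Ne, map_eq_zero_iff _ HahnSeries.ofPowerSeries_injective]
    refine pow_ne_zero 3 fun h => ?_
    have := congrArg PowerSeries.constantCoeff h
    simp at this
  rw [IsDeltaFactor, hζ, CubicRing.semisimpleFactor_eq p hα hβ hαβ, map_mul,
    mul_div_cancel_right₀ _ hne]
  have hcoe : ((1 - RatFunc.X + (p : RatFunc ℚ) * RatFunc.X ^ 2 : RatFunc ℚ) : LaurentSeries ℚ) =
      HahnSeries.ofPowerSeries ℤ ℚ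
        (1 - PowerSeries.X + (p : PowerSeries ℚ) * PowerSeries.X ^ 2) := by
    simp only [map_add, map_sub, map_mul, map_pow, map_one, map_natCast, RatFunc.coe_X,
      HahnSeries.ofPowerSeries_X]
  rw [← hcoe]
  exact (RingHom.injective _).eq_iff

end

theorem proposition4p1 (p : ℕ) [Fact p.Prime] (α β : ℤ) (k : ℕ)
    (hα : pExp p (α : LocZ p) = 0) (hβ : pExp p (β : LocZ p) = 0)
    (hβα : pExp p ((β : LocZ p) - (α : LocZ p)) = k) :
    -- the indices of the full ideals are powers of `p`, each attained finitely often
    (∀ I : Ideal (CubicRing (LocZ p) α β), IsFullIdeal p I → ∃ n : ℕ, idealIndex I = p ^ n) ∧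
    (∀ n : ℕ, {I : Ideal (CubicRing (LocZ p) α β) |
      IsFullIdeal p I ∧ idealIndex I = p ^ n}.Finite) ∧
    -- the formula as an identity of formal power series in `x = p ^ (-s)`
    formalZeta p (CubicRing (LocZ p) α β) =
      (1 - (p : PowerSeries ℚ) ^ k * PowerSeries.X ^ (2 * k)) *
          (1 - (p : PowerSeries ℚ) * PowerSeries.X ^ 2)⁻¹ * ((1 - PowerSeries.X) ^ 2)⁻¹ +
        (p : PowerSeries ℚ) ^ k * PowerSeries.X ^ (2 * k) * ((1 - PowerSeries.X) ^ 3)⁻¹ ∧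
    -- the formula as an identity of functions of `s`, with an absolutely convergent series;
    -- where `p * x ^ 2 = 1`, the removable singularity of the first quotient takes its value `k`
    (∀ s x : ℂ, 0 < s.re → x = (p : ℂ) ^ (-s) →
      ((p : ℂ) * x ^ 2 ≠ 1 →
        HasSum (fun I : {I : Ideal (CubicRing (LocZ p) α β) // IsFullIdeal p I} =>
            (idealIndex I.1 : ℂ) ^ (-s))
          ((1 - (p : ℂ) ^ k * x ^ (2 * k)) / (1 - (p : ℂ) * x ^ 2) * (1 / (1 - x) ^ 2) +
            (p : ℂ) ^ k * x ^ (2 * k) / (1 - x) ^ 3)) ∧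
      ((p : ℂ) * x ^ 2 = 1 →
        HasSum (fun I : {I : Ideal (CubicRing (LocZ p) α β) // IsFullIdeal p I} =>
            (idealIndex I.1 : ℂ) ^ (-s))
          ((k : ℂ) * (1 / (1 - x) ^ 2) + (p : ℂ) ^ k * x ^ (2 * k) / (1 - x) ^ 3))) ∧
    -- the Euler factor for `k = 1`
    (k = 1 → ∀ δ : RatFunc ℚ, IsDeltaFactor p α β δ ↔
      δ = 1 - RatFunc.X + (p : RatFunc ℚ) * RatFunc.X ^ 2) := by
  have hp : p.Prime := Fact.out
  obtain ⟨e, he⟩ := exists_param_equiv_fullIdeal p α β k hα hβ hβα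
  have hfib (n : ℕ) : {I : Ideal (CubicRing (LocZ p) α β) // IsFullIdeal p I ∧
      idealIndex I = p ^ n} ≃ {y : ℕ × QuadParam p k // y.1 + y.2.weight = n} :=
    (Equiv.subtypeSubtypeEquivSubtypeInter _ _).symm.trans <|
      (e.subtypeEquiv fun y => by rw [he, Nat.pow_right_inj hp.two_le]).symm
  have hgen := QuadParam.hasGenFun_add_weight (p := p) (k := k)
  rw [QuadParam.genFun_eq] at hgen
  have hζ := hgen.mk_natCard_eq hfib
  change formalZeta p _ = _ at hζ
  refine ⟨fun I hI => ?_, fun n => ?_, hζ, fun s x hs hx => ?_, ?_⟩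
  · obtain ⟨y, hy⟩ := e.surjective ⟨I, hI⟩
    exact ⟨_, by simpa [hy] using he y⟩
  · have := (hgen n).1
    exact Set.finite_coe_iff.1 (.of_equiv _ (hfib n).symm)
  · have hp1 : (1 : ℝ) < p := by exact_mod_cast hp.one_lt
    have hnorm : ‖x‖ < 1 := by
      rw [hx, Complex.norm_natCast_cpow_of_pos hp.pos, Complex.neg_re]
      exact Real.rpow_lt_one_of_one_lt_of_neg hp1 (neg_neg_of_pos hs)
    have hsum := QuadParam.hasSum_pow_add_weight (p := p) (k := k) hnorm
    have hterm : (fun I : {I : Ideal (CubicRing (LocZ p) α β) // IsFullIdeal p I} =>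
        (idealIndex I.1 : ℂ) ^ (-s)) ∘ e = fun y => x ^ (y.1 + y.2.weight) := by
      funext y
      rw [Function.comp_apply, he, hx, Nat.cast_pow, ← Complex.natCast_cpow_natCast_mul,
        mul_comm, Complex.cpow_mul_nat]
    rw [← hterm, e.hasSum_iff] at hsum
    exact ⟨fun h => QuadParam.sum_value_eq h ▸ hsum,
      fun h => QuadParam.sum_value_eq_of_eq_one h ▸ hsum⟩
  · rintro rfl δ
    refine isDeltaFactor_iff p ?_ ?_ ?_ ?_ δ
    -- If α, β or β - α vanished, its exponent would be infinite.
    · rintro rfl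
      simp [pExp] at hα
    · rintro rfl
      simp [pExp] at hβ
    · rintro rfl
      simp [pExp] at hβα
    · have h1 : (1 - PowerSeries.X : PowerSeries ℚ) * (1 - PowerSeries.X)⁻¹ = 1 :=
        PowerSeries.mul_inv_cancel _ (by simp)
      have h2 : (1 - (p : PowerSeries ℚ) * PowerSeries.X ^ 2) *
          (1 - (p : PowerSeries ℚ) * PowerSeries.X ^ 2)⁻¹ = 1 :=
        PowerSeries.mul_inv_cancel _ (by simp)
      have hinv (n : ℕ) : ((1 - PowerSeries.X : PowerSeries ℚ) ^ n)⁻¹ =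
          (1 - PowerSeries.X)⁻¹ ^ n := by
        rw [eq_comm, PowerSeries.eq_inv_iff_mul_eq_one (by simp), ← mul_pow, mul_comm, h1, one_pow]
      rw [hζ, hinv, hinv, pow_one, mul_one, h2]
      linear_combination (-(1 - PowerSeries.X : PowerSeries ℚ)⁻¹ ^ 2) * h1
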